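/- Let $d,T$ be nonnegative integers, $k\ge 1$ an integer, and $r=\min(d,T)$. The vector $k$-support norm $\|\cdot\|_{(k)}$ on $\mathbb{R}^r$ is the norm whose unit ball is the convex hull of $\{w\in\mathbb{R}^r : w \text{ has at most } k \text{ nonzero entries},\ \|w\|_2\le 1\}$ (that is, the Minkowski functional of this convex hull). For $W\in\mathbb{R}^{d\times T}$ let $\sigma(W)\in\mathbb{R}^r$ be the vector of singular values of $W$ in nonincreasing order; the spectral $k$-support norm of $W$ is $\|\sigma(W)\|_{(k)}$. Then the unit ball of the spectral $k$-support norm is the convex hull of the set of matrices of rank at most $k$ and Frobenius norm at most one: $$\{W\in\mathbb{R}^{d\times T} : \|\sigma(W)\|_{(k)}\le 1\}=\operatorname{co}\{W\in\mathbb{R}^{d\times T} : \operatorname{rank}(W)\le k,\ \|W\|_{\rm F}\le 1\}.$$ -/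

import Mathlib

noncomputable section

/-- The vector `k`-support norm on `ℝⁿ`: the norm whose unit ball is the convex hull of the vectors
with at most `k` nonzero entries and Euclidean norm at most one, that is, the Minkowski functional
of that convex hull. -/
def kSupportNorm {n : ℕ} (k : ℕ) (w : EuclideanSpace ℝ (Fin n)) : ℝ :=
  gauge (convexHull ℝ
    {v : EuclideanSpace ℝ (Fin n) | {i : Fin n | v i ≠ 0}.ncard ≤ k ∧ ‖v‖ ≤ 1}) w

/-- The vector `σ(W) ∈ ℝʳ`, `r = min d T`, of the singular values of a real `d × T` matrix in
nonincreasing order. -/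
def singularValueVector {d T : ℕ} (W : Matrix (Fin d) (Fin T) ℝ) :
    EuclideanSpace ℝ (Fin (min d T)) :=
  WithLp.toLp 2 fun i => (Matrix.toEuclideanLin W).singularValues (i : ℕ)

/-- The spectral `k`-support norm of a matrix: the `k`-support norm of its singular value vector. -/
def spectralKSupportNorm {d T : ℕ} (k : ℕ) (W : Matrix (Fin d) (Fin T) ℝ) : ℝ :=
  kSupportNorm k (singularValueVector W)

section

attribute [local instance] Matrix.frobeniusNormedAddCommGroup

/-- The Frobenius norm of a real matrix. -/
def frobeniusNorm {d T : ℕ} (W : Matrix (Fin d) (Fin T) ℝ) : ℝ := ‖W‖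

end

end

/-! Fix a singular value decomposition with singular vectors `u i`, `v i`. The linear map x ↦ U
diag(x) Vᵀ sends σ(W) to W and sparse unit vectors to generating matrices; the linear map A ↦ (⟨u i,
A (v i)⟩)ᵢ sends W to σ(W) and generating matrices into the hull of the sparse unit vectors. Linear
maps commute with convex hulls, so each map gives one inclusion.

The substantial point is the second map. With P the orthogonal projection onto the range of A,
Cauchy–Schwarz gives |⟨u i, A (v i)⟩| ≤ √(tᵢ) aᵢ, where tᵢ = ‖P (u i)‖² and aᵢ = ‖A (v i)‖. Bessel's
inequality gives tᵢ ≤ 1, ∑ tᵢ ≤ rank A ≤ k and ∑ aᵢ² ≤ ‖A‖_F² ≤ 1. A vector so dominated lies in the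
hull (`mem_convexHull_sparseUnitBall`), by separation and a bound for linear functionals on the
hypersimplex. -/

/-- In finite dimension, the convex hull of a compact set is compact. -/
theorem IsCompact.convexHull_of_finiteDimensional {E : Type*} [NormedAddCommGroup E]
    [NormedSpace ℝ E] [FiniteDimensional ℝ E] {s : Set E} (hs : IsCompact s) :
    IsCompact (convexHull ℝ s) := by
  classical
  obtain rfl | ⟨x₀, hx₀⟩ := s.eq_empty_or_nonempty
  · simp
  let f : (Fin (Module.finrank ℝ E + 1) → ℝ) × (Fin (Module.finrank ℝ E + 1) → E) → E :=
    fun p => ∑ i, p.1 i • p.2 i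
  have hf : Continuous f := by fun_prop
  have hK := ((isCompact_stdSimplex ℝ (Fin (Module.finrank ℝ E + 1))).prod
    (isCompact_univ_pi fun _ => hs)).image hf
  convert hK using 1
  apply Set.Subset.antisymm
  · intro x hx
    obtain ⟨ι, hι, z, w, hz, hind, hw, hw1, rfl⟩ := eq_pos_convex_span_of_mem_convexHull hx
    have hcard : Fintype.card ι ≤ Fintype.card (Fin (Module.finrank ℝ E + 1)) := by
      simpa using hind.card_le_finrank_succ.trans
        (Nat.succ_le_succ (Submodule.finrank_le _))
    obtain ⟨e⟩ := Function.Embedding.nonempty_of_card_le hcard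
    -- Carathéodory gives at most dim + 1 points; the family is padded to exactly dim + 1 by copies
    -- of `x₀` with weight zero.
    refine ⟨(Function.extend e w 0, Function.extend e z fun _ => x₀), ⟨⟨?_, ?_⟩, ?_⟩, ?_⟩
    · intro i
      by_cases hi : ∃ a, e a = i
      · obtain ⟨a, rfl⟩ := hi
        simpa [e.injective.extend_apply] using (hw a).le
      · simp [Function.extend_apply' _ _ _ hi]
    · rw [← hw1]
      refine (Fintype.sum_of_injective e e.injective _ _ ?_ ?_).symm
      · intro i hi
        simp [Function.extend_apply' _ _ _ hi]
      · intro a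
        simp [e.injective.extend_apply]
    · intro i _
      by_cases hi : ∃ a, e a = i
      · obtain ⟨a, rfl⟩ := hi
        simpa [e.injective.extend_apply] using hz ⟨a, rfl⟩
      · simpa [Function.extend_apply' _ _ _ hi] using hx₀
    · refine (Fintype.sum_of_injective e e.injective _ _ ?_ ?_).symm
      · intro i hi
        simp [Function.extend_apply' _ _ _ hi]
      · intro a
        simp [e.injective.extend_apply]
  · rintro _ ⟨⟨w, z⟩, ⟨hw, hz⟩, rfl⟩
    exact (convex_convexHull ℝ s).sum_mem (fun i _ => hw.1 i) hw.2
      fun i _ => subset_convexHull ℝ s (hz i trivial)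

/-! ### Sparse unit vectors and their convex hull -/

/-- The vectors with at most `k` nonzero entries and Euclidean norm at most one. -/
def sparseUnitBall (n k : ℕ) : Set (EuclideanSpace ℝ (Fin n)) :=
  {v | {i : Fin n | v i ≠ 0}.ncard ≤ k ∧ ‖v‖ ≤ 1}

theorem isCompact_sparseUnitBall (n k : ℕ) : IsCompact (sparseUnitBall n k) := by
  -- Sparsity describes a finite union of coordinate subspaces, hence a closed set.
  have h : sparseUnitBall n k = (⋃ S ∈ {S : Finset (Fin n) | S.card ≤ k},
      {v : EuclideanSpace ℝ (Fin n) | ∀ i ∉ S, v i = 0}) ∩ Metric.closedBall 0 1 := by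
    ext v
    simp only [sparseUnitBall, Set.mem_ofPred_eq, Set.mem_inter_iff, Set.mem_iUnion,
      mem_closedBall_zero_iff, exists_prop]
    refine and_congr_left fun _ => ⟨fun h => ?_, ?_⟩
    · refine ⟨Finset.univ.filter fun i => v i ≠ 0, ?_, by simp⟩
      simpa [Set.ncard_eq_toFinset_card'] using h
    · rintro ⟨S, hS, hv⟩
      refine le_trans ?_ hS
      rw [← Set.ncard_coe_finset]
      refine Set.ncard_le_ncard (fun i hi => ?_) S.finite_toSet
      by_contra hiS
      exact hi (hv i hiS)
  rw [h]
  refine (isCompact_closedBall _ _).inter_left ((Set.toFinite _).isClosed_biUnion fun S _ => ?_)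
  simp only [Set.ofPred_forall]
  refine isClosed_iInter fun i => isClosed_iInter fun _ => ?_
  exact isClosed_eq (by fun_prop) continuous_const

theorem convexHull_sparseUnitBall_mem_nhds_zero {n k : ℕ} (hk : 1 ≤ k) :
    convexHull ℝ (sparseUnitBall n k) ∈ nhds 0 := by
  obtain rfl | hn := Nat.eq_zero_or_pos n
  · refine Filter.mem_of_superset Filter.univ_mem fun x _ => subset_convexHull ℝ _ ?_
    rw [Subsingleton.elim x 0]
    simp [sparseUnitBall]
  have hn' : (0 : ℝ) < n := by exact_mod_cast hn
  refine Filter.mem_of_superset (Metric.closedBall_mem_nhds 0 (inv_pos.2 hn')) fun x hx => ?_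
  rw [mem_closedBall_zero_iff] at hx
  -- `x` is the average of its coordinate vectors scaled by `n`; these are 1-sparse, and of norm at
  -- most one when ‖x‖ ≤ 1/n.
  have hsum : x = ∑ i : Fin n, (n : ℝ)⁻¹ • EuclideanSpace.single i (n * x i) := by
    ext j
    simp [Pi.single_apply, hn'.ne']
  rw [hsum]
  refine (convex_convexHull ℝ _).sum_mem (fun _ _ => (inv_pos.2 hn').le) (by simp [hn'.ne'])
    fun i _ => subset_convexHull ℝ _ ⟨?_, ?_⟩
  · refine le_trans (Set.ncard_le_ncard (t := {i}) (fun j hj => ?_)) (by simpa using hk)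
    by_contra h
    exact hj (by simp [show j ≠ i from h])
  · have h1 : |x i| ≤ (n : ℝ)⁻¹ := (by simpa using PiLp.norm_apply_le x i : |x i| ≤ ‖x‖).trans hx
    calc ‖EuclideanSpace.single i ((n : ℝ) * x i)‖ = n * |x i| := by simp
      _ ≤ n * (n : ℝ)⁻¹ := by gcongr
      _ = 1 := mul_inv_cancel₀ hn'.ne'

/-- For a convex neighbourhood of zero, gauge at most one means membership in the closure;
compactness of the hull removes the closure. -/
theorem kSupportNorm_le_one_iff {n k : ℕ} (hk : 1 ≤ k) (w : EuclideanSpace ℝ (Fin n)) :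
    kSupportNorm k w ≤ 1 ↔ w ∈ convexHull ℝ (sparseUnitBall n k) := by
  rw [kSupportNorm, ← sparseUnitBall, gauge_le_one_iff_mem_closure (convex_convexHull ℝ _)
    (convexHull_sparseUnitBall_mem_nhds_zero hk),
    (isCompact_sparseUnitBall n k).convexHull_of_finiteDimensional.isClosed.closure_eq]

/-- A linear functional on the hypersimplex is bounded by a sum of at most `k` coefficients. -/
theorem exists_card_le_sum_mul_le_sum {ι : Type*} [Fintype ι] (k : ℕ) (t z : ι → ℝ)
    (hz : ∀ i, 0 ≤ z i) (ht0 : ∀ i, 0 ≤ t i) (ht1 : ∀ i, t i ≤ 1) (ht : ∑ i, t i ≤ k) :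
    ∃ S : Finset ι, S.card ≤ k ∧ ∑ i, t i * z i ≤ ∑ i ∈ S, z i := by
  classical
  by_cases hcard : Fintype.card ι ≤ k
  · exact ⟨Finset.univ, hcard, Finset.sum_le_sum fun i _ => by nlinarith [hz i, ht1 i]⟩
  push Not at hcard
  obtain ⟨S₀, -, hS₀⟩ := Finset.exists_subset_card_eq (s := (Finset.univ : Finset ι)) hcard.le
  obtain ⟨S, hS, hmax⟩ := Finset.exists_max_image (Finset.powersetCard k Finset.univ)
    (fun S : Finset ι => ∑ i ∈ S, z i) ⟨S₀, by simp [hS₀]⟩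
  have hSk : S.card = k := by simpa using hS
  -- `S` maximizes the sum among `k`-sets, so no exchange can increase it.
  have hexch : ∀ i ∈ S, ∀ j ∉ S, z j ≤ z i := by
    intro i hi j hj
    have hj' : j ∉ S.erase i := fun h => hj (Finset.mem_of_mem_erase h)
    have h := hmax (insert j (S.erase i)) (by
      simp only [Finset.mem_powersetCard, Finset.subset_univ, true_and]
      rw [Finset.card_insert_of_notMem hj', Finset.card_erase_add_one hi, hSk])
    rw [Finset.sum_insert hj', ← Finset.add_sum_erase S z hi] at h
    linarith
  obtain ⟨c, hc0, hcS, hcSc⟩ : ∃ c : ℝ, 0 ≤ c ∧ (∀ i ∈ S, c ≤ z i) ∧ ∀ j ∉ S, z j ≤ c := by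
    obtain ⟨j, hj, hjmax⟩ := Finset.exists_max_image Sᶜ z (by
      rw [← Finset.card_pos, Finset.card_compl]; omega)
    exact ⟨z j, hz j, fun i hi => hexch i hi j (by simpa using hj),
      fun i hi => hjmax i (by simpa using hi)⟩
  refine ⟨S, hSk.le, ?_⟩
  -- `c` separates the values on `S` from those off `S`. Summed over `i`, the right side is c (∑ tᵢ
  -- - k) ≤ 0.
  have hle : ∀ i, t i * z i - (if i ∈ S then z i else 0) ≤ c * (t i - if i ∈ S then 1 else 0) := by
    intro i
    split_ifs with hi
    · nlinarith [hcS i hi, ht1 i]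
    · nlinarith [hcSc i hi, ht0 i]
  have h := Finset.sum_le_sum fun i (_ : i ∈ Finset.univ) => hle i
  rw [Finset.sum_sub_distrib, ← Finset.mul_sum, Finset.sum_sub_distrib] at h
  simp only [Finset.sum_ite_mem, Finset.univ_inter, Finset.sum_const, nsmul_eq_mul, mul_one,
    hSk] at h
  nlinarith

/-- A vector dominated by `√tᵢ aᵢ`, with `t` in the hypersimplex and `a` in the unit ball, lies in
the convex hull of the sparse unit vectors. -/
theorem mem_convexHull_sparseUnitBall {n k : ℕ} (x : EuclideanSpace ℝ (Fin n)) (t a : Fin n → ℝ)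
    (ht0 : ∀ i, 0 ≤ t i) (ht1 : ∀ i, t i ≤ 1) (ht : ∑ i, t i ≤ k) (ha : ∑ i, a i ^ 2 ≤ 1)
    (hx : ∀ i, |x i| ≤ √(t i) * a i) :
    x ∈ convexHull ℝ (sparseUnitBall n k) := by
  by_contra hxC
  obtain ⟨f, u, hfu, hux⟩ := geometric_hahn_banach_closed_point (convex_convexHull ℝ _)
    (isCompact_sparseUnitBall n k).convexHull_of_finiteDimensional.isClosed hxC
  obtain ⟨y, rfl⟩ := (InnerProductSpace.toDual ℝ (EuclideanSpace ℝ (Fin n))).surjective f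
  simp only [InnerProductSpace.toDual_apply_apply] at hfu hux
  obtain ⟨S, hSk, hS⟩ := exists_card_le_sum_mul_le_sum k t (fun i => y i ^ 2)
    (fun _ => sq_nonneg _) ht0 ht1 ht
  set m : ℝ := √(∑ i ∈ S, y i ^ 2) with hm
  have hm2 : m ^ 2 = ∑ i ∈ S, y i ^ 2 := Real.sq_sqrt (Finset.sum_nonneg fun _ _ => sq_nonneg _)
  -- The normalized restriction of `y` to `S`, with ⟨y, v⟩ = m. When `m = 0`, the convention `0⁻¹ =
  -- 0` makes it the zero vector.
  let v : EuclideanSpace ℝ (Fin n) := WithLp.toLp 2 fun i => if i ∈ S then m⁻¹ * y i else 0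
  have hv : v ∈ sparseUnitBall n k := by
    refine ⟨?_, ?_⟩
    · refine le_trans ?_ hSk
      rw [← Set.ncard_coe_finset]
      refine Set.ncard_le_ncard (fun i hi => ?_) S.finite_toSet
      by_contra hiS
      exact hi (if_neg hiS)
    · have : ‖v‖ ^ 2 ≤ 1 := by
        simp only [EuclideanSpace.norm_sq_eq, v, Real.norm_eq_abs, sq_abs, ite_pow, mul_pow,
          zero_pow two_ne_zero, Finset.sum_ite_mem, Finset.univ_inter, ← Finset.mul_sum, ← hm2]
        rw [← mul_pow]
        rcases eq_or_ne m 0 with h | h <;> simp [h]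
      exact (sq_le_one_iff₀ (norm_nonneg _)).1 this
  have hvm : inner ℝ y v = m := by
    simp only [PiLp.inner_apply, v, RCLike.inner_apply, conj_trivial, ite_mul, zero_mul,
      Finset.sum_ite_mem, Finset.univ_inter, mul_assoc, ← pow_two, ← Finset.mul_sum, ← hm2]
    rcases eq_or_ne m 0 with h | h
    · simp [h]
    · field_simp
  have h1 := hfu v (subset_convexHull ℝ _ hv)
  have h2 : inner ℝ y x ≤ m := by
    calc inner ℝ y x = ∑ i, x i * y i := by simp [PiLp.inner_apply]
      _ ≤ ∑ i, (√(t i) * |y i|) * a i := by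
        refine Finset.sum_le_sum fun i _ => ?_
        calc x i * y i ≤ |x i| * |y i| := by rw [← abs_mul]; exact le_abs_self _
          _ ≤ √(t i) * a i * |y i| := by gcongr; exact hx i
          _ = _ := by ring
      _ ≤ √(∑ i, (√(t i) * |y i|) ^ 2) * √(∑ i, a i ^ 2) := Real.sum_mul_le_sqrt_mul_sqrt _ _ _
      _ ≤ √(∑ i, (√(t i) * |y i|) ^ 2) * 1 := by
        gcongr
        exact Real.sqrt_le_one.2 ha
      _ ≤ m := by
        rw [mul_one]
        refine Real.sqrt_le_sqrt (le_trans (le_of_eq ?_) hS)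
        exact Finset.sum_congr rfl fun i _ => by rw [mul_pow, Real.sq_sqrt (ht0 i), sq_abs]
  linarith

/-! ### Low-rank matrices of Frobenius norm at most one -/

theorem frobeniusNorm_sq {d T : ℕ} (W : Matrix (Fin d) (Fin T) ℝ) :
    frobeniusNorm W ^ 2 = ∑ i, ∑ j, W i j ^ 2 := by
  rw [frobeniusNorm, Matrix.frobenius_norm_def, ← Real.sqrt_eq_rpow, Real.sq_sqrt]
  · simp
  · positivity

theorem frobeniusNorm_nonneg {d T : ℕ} (W : Matrix (Fin d) (Fin T) ℝ) : 0 ≤ frobeniusNorm W :=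
  letI := Matrix.frobeniusNormedAddCommGroup (m := Fin d) (n := Fin T) (α := ℝ)
  norm_nonneg W

theorem frobeniusNorm_le_one_iff {d T : ℕ} (W : Matrix (Fin d) (Fin T) ℝ) :
    frobeniusNorm W ≤ 1 ↔ ∑ i, ∑ j, W i j ^ 2 ≤ 1 := by
  rw [← frobeniusNorm_sq, sq_le_one_iff₀ (frobeniusNorm_nonneg W)]

theorem sum_sum_sq_eq_trace {d T : ℕ} (W : Matrix (Fin d) (Fin T) ℝ) :
    ∑ i, ∑ j, W i j ^ 2 = (W.transpose * W).trace := by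
  rw [Finset.sum_comm]
  simp [Matrix.trace, Matrix.mul_apply, pow_two]

/-- A matrix with singular vectors in the columns of `U` and `V` is in the generating set when its
vector of coefficients is sparse of norm at most one. -/
theorem mul_diagonal_mul_transpose_mem {d T r k : ℕ} {U : Matrix (Fin d) (Fin r) ℝ}
    {V : Matrix (Fin T) (Fin r) ℝ} (hU : U.transpose * U = 1) (hV : V.transpose * V = 1)
    {x : EuclideanSpace ℝ (Fin r)} (hx : x ∈ sparseUnitBall r k) :
    (U * Matrix.diagonal x * V.transpose).rank ≤ k ∧
      frobeniusNorm (U * Matrix.diagonal x * V.transpose) ≤ 1 := by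
  classical
  refine ⟨?_, ?_⟩
  · refine (Matrix.rank_mul_le_left _ _).trans ((Matrix.rank_mul_le_right _ _).trans ?_)
    rw [Matrix.rank_diagonal, ← Nat.card_eq_fintype_card]
    exact hx.1
  · rw [frobeniusNorm_le_one_iff, sum_sum_sq_eq_trace]
    have h : (U * Matrix.diagonal x * V.transpose).transpose *
        (U * Matrix.diagonal x * V.transpose) =
        V * (Matrix.diagonal x * (U.transpose * U) * Matrix.diagonal x * V.transpose) := by
      simp [Matrix.transpose_mul, Matrix.mul_assoc]
    rw [h, hU, Matrix.trace_mul_comm, Matrix.mul_assoc, hV, Matrix.mul_one, Matrix.mul_one,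
      Matrix.diagonal_mul_diagonal, Matrix.trace_diagonal]
    have := pow_le_one₀ (n := 2) (norm_nonneg x) hx.2
    rw [EuclideanSpace.norm_sq_eq] at this
    simpa [pow_two] using this

/-- The vector of diagonal entries of a matrix of rank at most `k` and Frobenius norm at most one,
in any pair of orthonormal systems. -/
theorem inner_toEuclideanLin_mem_convexHull {d T r k : ℕ} {A : Matrix (Fin d) (Fin T) ℝ}
    (hA : A.rank ≤ k) (hF : frobeniusNorm A ≤ 1) {u : Fin r → EuclideanSpace ℝ (Fin d)}
    {v : Fin r → EuclideanSpace ℝ (Fin T)} (hu : Orthonormal ℝ u) (hv : Orthonormal ℝ v) :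
    (WithLp.toLp 2 fun i => inner ℝ (u i) (Matrix.toEuclideanLin A (v i)) :
      EuclideanSpace ℝ (Fin r)) ∈ convexHull ℝ (sparseUnitBall r k) := by
  set L := Matrix.toEuclideanLin A with hL
  set K := LinearMap.range L with hK
  have hKk : Module.finrank ℝ K ≤ k := by
    rwa [A.rank_eq_finrank_range_toLin (EuclideanSpace.basisFun _ ℝ).toBasis
      (EuclideanSpace.basisFun _ ℝ).toBasis, ← Matrix.toEuclideanLin_eq_toLin_orthonormal] at hA
  let e := stdOrthonormalBasis ℝ K
  have he : Orthonormal ℝ fun j => (e j : EuclideanSpace ℝ (Fin d)) :=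
    e.orthonormal.comp_linearIsometry K.subtypeₗᵢ
  refine mem_convexHull_sparseUnitBall _
    (fun i => ∑ j, inner ℝ (e j : EuclideanSpace ℝ (Fin d)) (u i) ^ 2)
    (fun i => ‖L (v i)‖) (fun i => Finset.sum_nonneg fun _ _ => sq_nonneg _) (fun i => ?_) ?_ ?_
    (fun i => ?_)
  · simpa [hu.1 i] using he.sum_inner_products_le (u i) (s := Finset.univ)
  · rw [Finset.sum_comm]
    have h : ∀ j, ∑ i, inner ℝ (e j : EuclideanSpace ℝ (Fin d)) (u i) ^ 2 ≤ 1 := by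
      intro j
      simpa [he.1 j, real_inner_comm] using
        hu.sum_inner_products_le (e j : EuclideanSpace ℝ (Fin d)) (s := Finset.univ)
    refine (Finset.sum_le_sum fun j _ => h j).trans ?_
    simpa using hKk
  · rw [frobeniusNorm_le_one_iff] at hF
    refine le_trans ?_ hF
    simp only [EuclideanSpace.norm_sq_eq, Real.norm_eq_abs, sq_abs]
    rw [Finset.sum_comm]
    refine Finset.sum_le_sum fun a _ => ?_
    -- Bessel for row `a` of `A`: its inner product with `v i` is the coordinate `a` of `L (v i)`.
    have h := hv.sum_inner_products_le (WithLp.toLp 2 (A a)) (s := Finset.univ)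
    simpa [EuclideanSpace.norm_sq_eq, hL, Matrix.toLpLin_apply, Matrix.mulVec, dotProduct,
      PiLp.inner_apply] using h
  · have hexp : inner ℝ (u i) (L (v i)) = ∑ j, inner ℝ (e j : EuclideanSpace ℝ (Fin d)) (u i) *
        inner ℝ (e j : EuclideanSpace ℝ (Fin d)) (L (v i)) := by
      have h := congrArg (Subtype.val) (e.sum_repr' ⟨L (v i), LinearMap.mem_range_self L _⟩)
      simp only [AddSubmonoidClass.coe_finsetSum, Submodule.coe_smul, Submodule.coe_inner] at h
      conv_lhs => rw [← h]
      simp only [inner_sum, inner_smul_right, real_inner_comm (u i)]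
      exact Finset.sum_congr rfl fun j _ => mul_comm _ _
    have hsq : ∑ j, inner ℝ (e j : EuclideanSpace ℝ (Fin d)) (L (v i)) ^ 2 ≤ ‖L (v i)‖ ^ 2 := by
      simpa using he.sum_inner_products_le (L (v i)) (s := Finset.univ)
    have hcs := Finset.sum_mul_sq_le_sq_mul_sq Finset.univ
      (fun j => inner ℝ (e j : EuclideanSpace ℝ (Fin d)) (u i))
      (fun j => inner ℝ (e j : EuclideanSpace ℝ (Fin d)) (L (v i)))
    rw [← hexp] at hcs
    refine abs_le_of_sq_le_sq ?_ (by positivity)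
    rw [mul_pow, Real.sq_sqrt (Finset.sum_nonneg fun _ _ => sq_nonneg _)]
    refine hcs.trans ?_
    gcongr

/-! ### Singular value decomposition -/

/-- The singular value decomposition of a real matrix. -/
theorem exists_singularValueDecomposition {d T : ℕ} (W : Matrix (Fin d) (Fin T) ℝ) :
    ∃ (u : Fin (min d T) → EuclideanSpace ℝ (Fin d))
      (v : Fin (min d T) → EuclideanSpace ℝ (Fin T)),
      Orthonormal ℝ u ∧ Orthonormal ℝ v ∧
      (∀ i, inner ℝ (u i) (Matrix.toEuclideanLin W (v i)) = singularValueVector W i) ∧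
      ∀ x, Matrix.toEuclideanLin W x =
        ∑ i, (singularValueVector W i * inner ℝ (v i) x) • u i := by
  set L := Matrix.toEuclideanLin W with hL
  have hn : Module.finrank ℝ (EuclideanSpace ℝ (Fin T)) = T := by simp
  let b := L.isSymmetric_adjoint_comp_self.eigenvectorBasis hn
  have hinner : ∀ i j, inner ℝ (L (b i)) (L (b j)) =
      if i = j then L.singularValues i ^ 2 else 0 := by
    intro i j
    rw [← LinearMap.adjoint_inner_right, ← LinearMap.comp_apply,
      L.isSymmetric_adjoint_comp_self.apply_eigenvectorBasis hn j, inner_smul_right,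
      ← L.sq_singularValues_fin hn j]
    have := orthonormal_iff_ite.1 b.orthonormal i j
    simp only [b] at this
    rw [this]
    split_ifs with h <;> simp [h]
  have hrange : Module.finrank ℝ (LinearMap.range L) ≤ d := by
    simpa using Submodule.finrank_le (LinearMap.range L)
  -- Normalized images of the right singular vectors. They are orthonormal only on `s`, where the
  -- singular value is nonzero; elsewhere the basis extension `c` supplies arbitrary left vectors.
  let w : Fin d → EuclideanSpace ℝ (Fin d) := fun i =>
    if h : (i : ℕ) < T then (L.singularValues i)⁻¹ • L (b ⟨i, h⟩) else 0
  let s : Set (Fin d) := {i | (i : ℕ) < T ∧ L.singularValues i ≠ 0}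
  have hw : Orthonormal ℝ (s.domRestrict w) := by
    rw [orthonormal_iff_ite]
    rintro ⟨i, hi, hi0⟩ ⟨j, hj, hj0⟩
    simp only [Set.domRestrict_apply, w, hi, hj, dif_pos, inner_smul_left, inner_smul_right, hinner,
      conj_trivial, Subtype.mk.injEq, Fin.ext_iff]
    split_ifs with h
    · rw [← h]
      field_simp
    · simp
  obtain ⟨c, hc⟩ := hw.exists_orthonormalBasis_extension_of_card_eq (by simp)
  have hLb : ∀ (i : ℕ) (hd : i < d) (hT : i < T),
      L (b ⟨i, hT⟩) = L.singularValues i • c ⟨i, hd⟩ := by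
    intro i hd hT
    by_cases h0 : L.singularValues i = 0
    · have := hinner ⟨i, hT⟩ ⟨i, hT⟩
      simp only [h0, if_true, zero_pow two_ne_zero, inner_self_eq_zero] at this
      simp [this, h0]
    · rw [hc ⟨i, hd⟩ ⟨hT, h0⟩]
      simp [w, hT, h0]
  -- The rank is at most `d`, so the right singular vectors beyond the first `min d T` are killed.
  have hLb0 : ∀ i : Fin T, d ≤ i → L (b i) = 0 := by
    intro i hi
    have h0 := L.singularValues_eq_zero_iff_le_finrank_range.2 (hrange.trans hi)
    have := hinner i i
    simpa only [h0, if_true, zero_pow two_ne_zero, inner_self_eq_zero] using this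
  have hd : ∀ i : Fin (min d T), (i : ℕ) < d := fun i => i.2.trans_le (min_le_left _ _)
  have hT : ∀ i : Fin (min d T), (i : ℕ) < T := fun i => i.2.trans_le (min_le_right _ _)
  refine ⟨fun i => c ⟨i, hd i⟩, fun i => b ⟨i, hT i⟩, ?_, ?_, ?_, ?_⟩
  · exact c.orthonormal.comp (fun i : Fin (min d T) => ⟨i, hd i⟩) fun i j h => Fin.ext (by simpa using h)
  · exact b.orthonormal.comp (fun i : Fin (min d T) => ⟨i, hT i⟩) fun i j h => Fin.ext (by simpa using h)
  · intro i
    rw [hLb i (hd i) (hT i), inner_smul_right, inner_self_eq_norm_sq_to_K, c.orthonormal.1]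
    simp [singularValueVector, hL]
  · intro x
    conv_lhs => rw [← b.sum_repr' x]
    simp only [map_sum, map_smul]
    refine (Fintype.sum_of_injective (fun i : Fin (min d T) => (⟨i, hT i⟩ : Fin T))
      (fun i j h => Fin.ext (by simpa using h)) _ _ ?_ ?_).symm
    · intro i hi
      rw [hLb0 i, smul_zero]
      by_contra h
      exact hi ⟨⟨i, by simp; omega⟩, rfl⟩
    · intro i
      rw [hLb i (hd i) (hT i), smul_smul, mul_comm]
      simp [singularValueVector, hL]

theorem transpose_mul_self_of_orthonormal {m r : ℕ} {u : Fin r → EuclideanSpace ℝ (Fin m)}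
    (hu : Orthonormal ℝ u) :
    (Matrix.of fun a i => u i a).transpose * (Matrix.of fun a i => u i a) = 1 := by
  ext i j
  have := orthonormal_iff_ite.1 hu j i
  simpa [Matrix.mul_apply, Matrix.one_apply, PiLp.inner_apply, eq_comm (a := j)] using this

/-! ### The two inclusions -/

theorem mainTheorem4 (d T k : ℕ) (hk : 1 ≤ k) :
    {W : Matrix (Fin d) (Fin T) ℝ | spectralKSupportNorm k W ≤ 1} =
      convexHull ℝ {W : Matrix (Fin d) (Fin T) ℝ | W.rank ≤ k ∧ frobeniusNorm W ≤ 1} := by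
  ext W
  obtain ⟨u, v, hu, hv, hdiag, hW⟩ := exists_singularValueDecomposition W
  rw [Set.mem_ofPred_eq, spectralKSupportNorm, kSupportNorm_le_one_iff hk]
  constructor
  · intro hσ
    let U : Matrix (Fin d) (Fin (min d T)) ℝ := Matrix.of fun a i => u i a
    let V : Matrix (Fin T) (Fin (min d T)) ℝ := Matrix.of fun a i => v i a
    let Φ : EuclideanSpace ℝ (Fin (min d T)) →ₗ[ℝ] Matrix (Fin d) (Fin T) ℝ :=
      { toFun := fun x => U * Matrix.diagonal x * V.transpose
        map_add' := fun x y => by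
          rw [← Matrix.add_mul, ← Matrix.mul_add, Matrix.diagonal_add]; rfl
        map_smul' := fun c x => by
          rw [RingHom.id_apply, ← Matrix.smul_mul, ← Matrix.mul_smul, ← Matrix.diagonal_smul]
          rfl }
    have hΦ : Φ (singularValueVector W) = W := by
      ext a j
      -- The decomposition applied to the `j`-th basis vector gives column `j` of `W`.
      have h := congrArg (fun y : EuclideanSpace ℝ (Fin d) => y a) (hW (EuclideanSpace.single j 1))
      simp only [Matrix.toLpLin_apply] at h
      simp only [Φ, LinearMap.coe_mk, AddHom.coe_mk, Matrix.mul_apply (N := V.transpose),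
        Matrix.mul_diagonal, Matrix.transpose_apply, U, V, Matrix.of_apply]
      simp [EuclideanSpace.inner_single_right] at h
      rw [h]
      exact Finset.sum_congr rfl fun i _ => by ring
    have h := Set.mem_image_of_mem Φ hσ
    rw [Φ.image_convexHull, hΦ] at h
    refine convexHull_mono ?_ h
    rintro _ ⟨x, hx, rfl⟩
    exact mul_diagonal_mul_transpose_mem (transpose_mul_self_of_orthonormal hu)
      (transpose_mul_self_of_orthonormal hv) hx
  · intro hWM
    let Ψ : Matrix (Fin d) (Fin T) ℝ →ₗ[ℝ] EuclideanSpace ℝ (Fin (min d T)) :=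
      { toFun := fun A => WithLp.toLp 2 fun i => inner ℝ (u i) (Matrix.toEuclideanLin A (v i))
        map_add' := fun A B => by ext i; simp [inner_add_right]
        map_smul' := fun c A => by ext i; simp [inner_smul_right] }
    have hΨ : Ψ W = singularValueVector W := by
      ext i
      exact hdiag i
    have h := Set.mem_image_of_mem Ψ hWM
    rw [Ψ.image_convexHull, hΨ] at h
    refine convexHull_min ?_ (convex_convexHull ℝ _) h
    rintro _ ⟨A, hA, rfl⟩
    exact inner_toEuclideanLin_mem_convexHull hA.1 hA.2 hu hv
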